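/- Let $G$ be a finite connected undirected graph without loops on a vertex set $V$ with at least two vertices, with positive edge weights $c_{uv}=c_{vu}$ (and $c_{uv}=0$ for non-edges). Put $c_v=\sum_u c_{uv}$, let $D$ be the diagonal matrix of the degrees $c_v$, let $L=D-(c_{uv})_{u,v}$ be the Laplacian, $N=D^{-1/2}LD^{-1/2}$ the normalized Laplacian, and $\lambda_G$ the smallest nonzero eigenvalue of $N$. For a nonempty set $X\subseteq V$, let $\mathrm{Schur}(G,X)$ be the weighted graph on $X$ whose Laplacian is the Schur complement $$L[X,X]-L[X,V\setminus X]\,L[V\setminus X,V\setminus X]^{-1}\,L[V\setminus X,X].$$ For disjoint nonempty $A,B\subseteq V$, put $I=\mathrm{Schur}(G,A\cup B)$ and $$\rho_{A,B}=\frac{c^I(A,B)}{\min(\mathrm{vol}_I(A),\mathrm{vol}_I(B))},$$ where $c^I(A,B)$ is the total weight of the edges of $I$ between $A$ and $B$, and $\mathrm{vol}_I(S)$ is the sum of the weighted degrees in $I$ of the vertices of $S$. Let $\rho_G=\min_{A,B}\rho_{A,B}$ over all pairs of disjoint nonempty sets $A,B\subseteq V$. Then both minima $\lambda_G$ and $\rho_G$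 exist, and $$\frac{\lambda_G}{2}\le\rho_G\le 25600\,\lambda_G.$$ -/

import Mathlib

open scoped Matrix

/-- A finite weighted undirected graph on `V`, given by its symmetric nonnegative edge weights;
`u` and `v` are joined by an edge exactly when `0 < c u v`. There are no loops. -/
structure WeightedGraph (V : Type*) where
  c : V → V → ℝ
  symm : ∀ u v, c u v = c v u
  nonneg : ∀ u v, 0 ≤ c u v
  loopless : ∀ v, c v v = 0

namespace WeightedGraph

noncomputable section

variable {V : Type*}

/-- The underlying simple graph, whose edges are the pairs of positive weight. -/
def support (G : WeightedGraph V) : SimpleGraph V where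
  Adj u v := 0 < G.c u v
  symm := ⟨fun u v h => by rw [G.symm v u]; exact h⟩
  loopless := ⟨fun v h => by simp [G.loopless v] at h⟩

/-- The graph is connected (through edges of positive weight). -/
def Connected (G : WeightedGraph V) : Prop := G.support.Connected

/-- Total weight of the edges between `A` and `B`, for disjoint `A` and `B`. -/
def cut (G : WeightedGraph V) (A B : Finset V) : ℝ := ∑ a ∈ A, ∑ b ∈ B, G.c a b

variable [Fintype V]

/-- Weighted degree of a vertex. -/
def deg (G : WeightedGraph V) (v : V) : ℝ := ∑ u, G.c v u

/-- Volume of a vertex set: the sum of the weighted degrees. -/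
def vol (G : WeightedGraph V) (A : Finset V) : ℝ := ∑ v ∈ A, G.deg v

theorem energy_eq_zero (G : WeightedGraph V) (n : V → ℝ)
    (h : ∑ v, ∑ u, G.c v u * (n v - n u) ^ 2 ≤ 0) (v u : V) : G.c v u * (n v - n u) = 0 := by
  have h0 : ∀ v u, 0 ≤ G.c v u * (n v - n u) ^ 2 := fun v u =>
    mul_nonneg (G.nonneg v u) (sq_nonneg _)
  have h1 : G.c v u * (n v - n u) ^ 2 ≤ 0 :=
    calc G.c v u * (n v - n u) ^ 2 ≤ ∑ u, G.c v u * (n v - n u) ^ 2 :=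
          Finset.single_le_sum (f := fun u => G.c v u * (n v - n u) ^ 2)
            (fun u _ => h0 v u) (Finset.mem_univ u)
      _ ≤ ∑ v, ∑ u, G.c v u * (n v - n u) ^ 2 :=
          Finset.single_le_sum (f := fun v => ∑ u, G.c v u * (n v - n u) ^ 2)
            (fun v _ => Finset.sum_nonneg fun u _ => h0 v u) (Finset.mem_univ v)
      _ ≤ 0 := h
  rcases mul_eq_zero.mp (le_antisymm h1 (h0 v u)) with h2 | h2
  · simp [h2]
  · simp [pow_eq_zero_iff two_ne_zero |>.mp h2]

variable [DecidableEq V]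

/-- The Laplacian matrix `D - A`. -/
def laplacian (G : WeightedGraph V) : Matrix V V ℝ :=
  Matrix.diagonal G.deg - Matrix.of G.c

/-- The normalized Laplacian matrix `D^{-1/2} L D^{-1/2}`. -/
def normLaplacian (G : WeightedGraph V) : Matrix V V ℝ :=
  Matrix.diagonal (fun v => (√(G.deg v))⁻¹) * G.laplacian *
    Matrix.diagonal (fun v => (√(G.deg v))⁻¹)

/-- The nonzero eigenvalues of the normalized Laplacian. -/
def nonzeroEigenvalues (G : WeightedGraph V) : Set ℝ :=
  {μ | μ ≠ 0 ∧ Module.End.HasEigenvalue (Matrix.toLin' G.normLaplacian) μ}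

/-- The smallest nonzero eigenvalue of the normalized Laplacian. -/
def spectralGap (G : WeightedGraph V) : ℝ := sInf G.nonzeroEigenvalues

/-- The Schur complement of the Laplacian onto the rows and columns indexed by `X`. -/
def schurMatrix (G : WeightedGraph V) (X : Finset V) :
    Matrix {v // v ∈ X} {v // v ∈ X} ℝ :=
  G.laplacian.submatrix (fun v => v.1) (fun v => v.1) -
    G.laplacian.submatrix (fun v => v.1) (fun v : {v // v ∉ X} => v.1) *
      (G.laplacian.submatrix (fun v : {v // v ∉ X} => v.1) (fun v : {v // v ∉ X} => v.1))⁻¹ *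
      G.laplacian.submatrix (fun v : {v // v ∉ X} => v.1) (fun v => v.1)

/-! Facts that make the Schur complement a weighted graph. -/

theorem laplacian_symm (G : WeightedGraph V) : G.laplacianᵀ = G.laplacian := by
  ext u v
  by_cases h : u = v
  · subst h; simp
  · simp [laplacian, h, Ne.symm h, G.symm u v]

theorem laplacian_nonpos (G : WeightedGraph V) {u v : V} (h : u ≠ v) : G.laplacian u v ≤ 0 := by
  simp [laplacian, h, G.nonneg u v]

theorem laplacian_mulVec (G : WeightedGraph V) (y : V → ℝ) (v : V) :
    (G.laplacian *ᵥ y) v = ∑ u, G.c v u * (y v - y u) := by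
  simp only [laplacian, Matrix.sub_mulVec, Pi.sub_apply, Matrix.mulVec_diagonal, mul_sub,
    Finset.sum_sub_distrib, deg, ← Finset.sum_mul]
  rfl

theorem sum_mul_laplacian (G : WeightedGraph V) (n y : V → ℝ) :
    2 * ∑ v, n v * (G.laplacian *ᵥ y) v = ∑ v, ∑ u, G.c v u * ((n v - n u) * (y v - y u)) := by
  have h1 : ∑ v, n v * (G.laplacian *ᵥ y) v = ∑ v, ∑ u, n v * (G.c v u * (y v - y u)) := by
    simp only [laplacian_mulVec, Finset.mul_sum]
  have h2 : ∑ v, n v * (G.laplacian *ᵥ y) v = ∑ v, ∑ u, n u * (G.c v u * (y u - y v)) := by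
    rw [h1, Finset.sum_comm]
    refine Finset.sum_congr rfl fun v _ => Finset.sum_congr rfl fun u _ => ?_
    rw [G.symm u v]
  rw [two_mul]
  nth_rewrite 1 [h1]
  rw [h2, ← Finset.sum_add_distrib]
  refine Finset.sum_congr rfl fun v _ => ?_
  rw [← Finset.sum_add_distrib]
  exact Finset.sum_congr rfl fun u _ => by ring

/-- Extension by zero of a vector on the eliminated vertices. -/
def extend (X : Finset V) (x : {v // v ∉ X} → ℝ) (v : V) : ℝ := if h : v ∉ X then x ⟨v, h⟩ else 0

theorem submatrix_mulVec_extend (G : WeightedGraph V) (X : Finset V) (x : {v // v ∉ X} → ℝ)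
    (v : {v // v ∉ X}) :
    (G.laplacian.submatrix (fun v : {v // v ∉ X} => v.1) (fun v : {v // v ∉ X} => v.1) *ᵥ x) v =
      (G.laplacian *ᵥ extend X x) v.1 := by
  simp only [Matrix.mulVec, dotProduct, Matrix.submatrix_apply]
  rw [← Fintype.sum_subtype_add_sum_subtype (fun v => v ∉ X)
    (fun u => G.laplacian v.1 u * extend X x u)]
  have h : ∑ u : {u // ¬ u ∉ X}, G.laplacian v.1 u.1 * extend X x u.1 = 0 :=
    Finset.sum_eq_zero fun u _ => by simp [extend, not_not.mp u.2]
  rw [h, add_zero]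
  exact Finset.sum_congr rfl fun u _ => by simp [extend, u.2]

theorem inv_submatrix_nonneg (G : WeightedGraph V) (X : Finset V) (i j : {v // v ∉ X}) :
    0 ≤ (G.laplacian.submatrix (fun v : {v // v ∉ X} => v.1)
      (fun v : {v // v ∉ X} => v.1))⁻¹ i j := by
  have hext := G.submatrix_mulVec_extend X
  set M := G.laplacian.submatrix (fun v : {v // v ∉ X} => v.1) (fun v : {v // v ∉ X} => v.1)
    with hM
  by_cases hu : IsUnit M.det
  swap
  · simp [Matrix.nonsing_inv_apply_not_isUnit _ hu]
  set x : {v // v ∉ X} → ℝ := M⁻¹ *ᵥ Pi.single j 1 with hx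
  have hxi : x i = M⁻¹ i j := by simp [hx]
  have hMx : M *ᵥ x = Pi.single j 1 := by
    rw [hx, Matrix.mulVec_mulVec, Matrix.mul_nonsing_inv _ hu, Matrix.one_mulVec]
  set m : {v // v ∉ X} → ℝ := fun v => max (-x v) 0 with hm
  set n := extend X m with hn
  set y := extend X x with hy
  have hny : ∀ v, n v = max (-y v) 0 := by
    intro v
    by_cases h : v ∈ X <;> simp [hn, hy, extend, h, hm]
  have h1 : 0 ≤ ∑ v, n v * (G.laplacian *ᵥ y) v := by
    refine Finset.sum_nonneg fun v _ => ?_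
    by_cases h : v ∈ X
    · simp [hn, extend, h]
    · refine mul_nonneg (by rw [hny]; exact le_max_right _ _) ?_
      have := hext x ⟨v, h⟩
      rw [hMx] at this
      rw [← this, Pi.single_apply]
      split_ifs <;> norm_num
  have h2 : ∑ v, ∑ u, G.c v u * ((n v - n u) * (y v - y u)) ≤
      -∑ v, ∑ u, G.c v u * (n v - n u) ^ 2 := by
    rw [← Finset.sum_neg_distrib]
    refine Finset.sum_le_sum fun v _ => ?_
    rw [← Finset.sum_neg_distrib]
    refine Finset.sum_le_sum fun u _ => ?_
    rw [← mul_neg]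
    refine mul_le_mul_of_nonneg_left ?_ (G.nonneg v u)
    rw [hny v, hny u]
    rcases max_cases (-y v) 0 with ⟨e1, e2⟩ | ⟨e1, e2⟩ <;>
      rcases max_cases (-y u) 0 with ⟨e3, e4⟩ | ⟨e3, e4⟩ <;> rw [e1, e3] <;> nlinarith
  have h3 := G.energy_eq_zero n (by have := G.sum_mul_laplacian n y; linarith)
  have h4 : M *ᵥ m = 0 := by
    ext v
    rw [hext m v, laplacian_mulVec]
    exact Finset.sum_eq_zero fun u _ => h3 _ _
  have h5 : m = 0 := by
    have : M⁻¹ *ᵥ (M *ᵥ m) = m := by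
      rw [Matrix.mulVec_mulVec, Matrix.nonsing_inv_mul _ hu, Matrix.one_mulVec]
    rw [← this, h4, Matrix.mulVec_zero]
  have h6 : max (-x i) 0 = 0 := congrFun h5 i
  have h7 := le_max_left (-x i) 0
  rw [← hxi]
  linarith

theorem schurMatrix_symm (G : WeightedGraph V) (X : Finset V) (u v : {v // v ∈ X}) :
    G.schurMatrix X u v = G.schurMatrix X v u := by
  have : (G.schurMatrix X)ᵀ = G.schurMatrix X := by
    simp [schurMatrix, Matrix.transpose_mul, Matrix.transpose_nonsing_inv,
      Matrix.transpose_submatrix, laplacian_symm, Matrix.mul_assoc]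
  exact congrFun (congrFun this v) u

theorem schurMatrix_nonpos (G : WeightedGraph V) (X : Finset V) {u v : {v // v ∈ X}}
    (h : u ≠ v) : G.schurMatrix X u v ≤ 0 := by
  have h1 : G.laplacian u.1 v.1 ≤ 0 := G.laplacian_nonpos fun e => h (Subtype.ext e)
  simp only [schurMatrix, Matrix.sub_apply, Matrix.mul_apply, Matrix.submatrix_apply]
  refine sub_nonpos.mpr (h1.trans (Finset.sum_nonneg fun j _ => ?_))
  refine mul_nonneg_of_nonpos_of_nonpos (Finset.sum_nonpos fun i _ => ?_) ?_
  · exact mul_nonpos_of_nonpos_of_nonneg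
      (G.laplacian_nonpos fun e => i.2 (e ▸ u.2)) (G.inv_submatrix_nonneg X i j)
  · exact G.laplacian_nonpos fun e => j.2 (e ▸ v.2)

/-- The Schur complement of `G` onto `X`: the weighted graph on `X` whose Laplacian is
`G.schurMatrix X` (see `laplacian_schur`). -/
def schur (G : WeightedGraph V) (X : Finset V) : WeightedGraph {v // v ∈ X} where
  c u v := if u = v then 0 else -G.schurMatrix X u v
  symm u v := by
    by_cases h : u = v
    · simp [h]
    · simp [h, Ne.symm h, G.schurMatrix_symm X u v]
  nonneg u v := by
    by_cases h : u = v
    · simp [h]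
    · simpa [h] using G.schurMatrix_nonpos X h
  loopless v := by simp

theorem isUnit_det_submatrix (G : WeightedGraph V) (hG : G.Connected) {X : Finset V}
    (hX : X.Nonempty) :
    IsUnit (G.laplacian.submatrix (fun v : {v // v ∉ X} => v.1)
      (fun v : {v // v ∉ X} => v.1)).det := by
  have hext := G.submatrix_mulVec_extend X
  set M := G.laplacian.submatrix (fun v : {v // v ∉ X} => v.1) (fun v : {v // v ∉ X} => v.1)
  rw [isUnit_iff_ne_zero]
  intro hdet
  obtain ⟨x, hx0, hx⟩ := Matrix.exists_mulVec_eq_zero_iff.mpr hdet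
  apply hx0
  have h1 : ∑ v, extend X x v * (G.laplacian *ᵥ extend X x) v = 0 := by
    refine Finset.sum_eq_zero fun v _ => ?_
    by_cases h : v ∈ X
    · simp [extend, h]
    · rw [← hext x ⟨v, h⟩, hx]; simp
  have h2 := G.sum_mul_laplacian (extend X x) (extend X x)
  have h3 := G.energy_eq_zero (extend X x) (by
    simp only [pow_two]; rw [← h2, h1]; simp)
  have h4 : ∀ u v, G.support.Reachable u v → extend X x u = extend X x v := by
    rintro u v ⟨p⟩
    induction p with
    | nil => rfl
    | cons h p ih =>
      rw [← ih]
      have := (mul_eq_zero.mp (h3 _ _)).resolve_left (ne_of_gt h)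
      linarith
  obtain ⟨w, hw⟩ := hX
  ext v
  have := h4 v.1 w (hG.preconnected _ _)
  simpa [extend, hw, v.2] using this

/-- For a connected graph and nonempty `X`, the Laplacian of `G.schur X` is indeed the Schur
complement of the Laplacian of `G`. -/
theorem laplacian_schur (G : WeightedGraph V) (hG : G.Connected) {X : Finset V}
    (hX : X.Nonempty) : (G.schur X).laplacian = G.schurMatrix X := by
  have hu := G.isUnit_det_submatrix hG hX
  have hrow : ∀ v, ∑ u, G.laplacian v u = 0 := by
    intro v
    have := G.laplacian_mulVec (fun _ => 1) v
    simpa [Matrix.mulVec, dotProduct] using this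
  have hsplit : ∀ v, ∑ u : {u // u ∈ X}, G.laplacian v u.1 +
      ∑ u : {u // u ∉ X}, G.laplacian v u.1 = 0 := by
    intro v
    rw [← hrow v, ← Fintype.sum_subtype_add_sum_subtype (fun v => v ∈ X)]
    congr 1
    exact Finset.sum_congr (by ext; simp) fun _ _ => rfl
  have hone : G.schurMatrix X *ᵥ (fun _ => 1) = 0 := by
    have e1 : G.laplacian.submatrix (fun v : {v // v ∉ X} => v.1) (fun v : {v // v ∈ X} => v.1) *ᵥ
        (fun _ => 1) = -(G.laplacian.submatrix (fun v : {v // v ∉ X} => v.1)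
          (fun v : {v // v ∉ X} => v.1) *ᵥ (fun _ => 1)) := by
      ext v
      have := hsplit v.1
      simp only [Matrix.mulVec, dotProduct, Matrix.submatrix_apply, mul_one, Pi.neg_apply]
      linarith
    rw [schurMatrix, Matrix.sub_mulVec, ← Matrix.mulVec_mulVec, e1, Matrix.mulVec_neg,
      Matrix.mulVec_mulVec, Matrix.mul_assoc, Matrix.nonsing_inv_mul _ hu, Matrix.mul_one]
    ext v
    have := hsplit v.1
    simp only [Matrix.mulVec, dotProduct, Matrix.submatrix_apply, mul_one, Pi.sub_apply,
      Pi.neg_apply, Pi.zero_apply]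
    linarith
  ext u v
  by_cases h : u = v
  · subst h
    have h1 : ∑ w, G.schurMatrix X u w = 0 := by
      simpa [Matrix.mulVec, dotProduct] using congrFun hone u
    have h2 : (G.schur X).laplacian u u = ∑ w, (if u = w then 0 else -G.schurMatrix X u w) := by
      simp [laplacian, deg, schur]
    have h3 : ∀ w, (if u = w then 0 else -G.schurMatrix X u w) =
        (if u = w then G.schurMatrix X u u else 0) - G.schurMatrix X u w := by
      intro w
      split_ifs with e
      · subst e; ring
      · ring
    rw [h2, Finset.sum_congr rfl fun w _ => h3 w, Finset.sum_sub_distrib, h1]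
    simp
  · simp [laplacian, schur, h]

/-- The fractional conductance of the cut between `A` and `B` in the Schur complement of `G`
onto `A ∪ B`. -/
def schurConductance (G : WeightedGraph V) (A B : Finset V) : ℝ :=
  (G.schur (A ∪ B)).cut (A.subtype (· ∈ A ∪ B)) (B.subtype (· ∈ A ∪ B)) /
    min ((G.schur (A ∪ B)).vol (A.subtype (· ∈ A ∪ B)))
      ((G.schur (A ∪ B)).vol (B.subtype (· ∈ A ∪ B)))

/-- The values of `schurConductance` over all pairs of disjoint nonempty vertex sets. -/
def schurConductances (G : WeightedGraph V) : Set ℝ :=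
  {r | ∃ A B : Finset V, A.Nonempty ∧ B.Nonempty ∧ Disjoint A B ∧ r = G.schurConductance A B}

/-- The Schur complement fractional conductance of `G`: the minimum of `schurConductance A B`
over disjoint nonempty `A`, `B`. -/
def minSchurConductance (G : WeightedGraph V) : ℝ := sInf G.schurConductances

end

end WeightedGraph

/-!
By Dirichlet's principle, the energy `xᵀ L x` of the graph `Schur(G, A ∪ B)` is the minimum of the
energy of `G` over all extensions, so `c^I(A, B)` is the least energy of a function that is `1` on
`A` and `0` on `B`. Applying the Poincaré inequality to the minimizer gives the lower bound.

For the upper bound, take an eigenfunction for `λ_G`, subtract a median, and let `f` be the positive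
or the negative part, whichever has Rayleigh quotient at most `λ_G`; its support has at most half of
the total volume. Take `A = {f ≥ t}` and `B = {f < t / 2}`, and bound `c^I(A, B)` by the energy of
the function of `f` that is linear between the levels `t / 2` and `t`. When the cuts of the
superlevel sets at `t` and `t / 2` are at most half of `vol {f ≥ t}`, the volumes in `I` are
comparable to those in `G`. A good `t` is found by averaging over `τ = t²`: the volume of `{f ≥ t}`
integrates to `‖f‖²`, the cuts to `O(√λ_G) ‖f‖²` as in Cheeger's inequality, and the energies of the
truncations only to `O(λ_G) ‖f‖²`. This works for `λ_G ≤ 1 / 288`; beyond that `ρ ≤ 1` suffices.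
-/

theorem exists_weighted_median {ι α : Type*} [Fintype ι] [Nonempty ι] [LinearOrder α]
    {w : ι → ℝ} (hw : ∀ i, 0 ≤ w i) (x : ι → α) :
    ∃ i, 2 * ∑ j with x j < x i, w j ≤ ∑ j, w j ∧ 2 * ∑ j with x i < x j, w j ≤ ∑ j, w j := by
  classical
  -- maximize `x i` subject to the first inequality
  let S : Finset ι := {i | 2 * ∑ j with x j < x i, w j ≤ ∑ j, w j}
  have hS : S.Nonempty := by
    obtain ⟨i, -, hi⟩ := Finset.exists_min_image Finset.univ x Finset.univ_nonempty
    have hempty : ({j | x j < x i} : Finset ι) = ∅ :=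
      Finset.filter_eq_empty_iff.mpr fun j hj => (hi j hj).not_gt
    exact ⟨i, by simp [S, hempty, Finset.sum_nonneg fun i _ => hw i]⟩
  obtain ⟨i, hiS, hmax⟩ := Finset.exists_max_image S x hS
  refine ⟨i, (Finset.mem_filter.mp hiS).2, ?_⟩
  by_contra! hlt
  have hT : ({j | x i < x j} : Finset ι).Nonempty := by
    by_contra! hempty
    rw [hempty, Finset.sum_empty, mul_zero] at hlt
    exact hlt.not_ge (Finset.sum_nonneg fun i _ => hw i)
  obtain ⟨k, hk, hmin⟩ := Finset.exists_min_image _ x hT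
  simp only [Finset.mem_filter_univ] at hk hmin
  have hbelow : ({j | x j < x k} : Finset ι) = ({j | ¬ x i < x j} : Finset ι) := by
    ext j
    simp only [Finset.mem_filter_univ]
    exact ⟨fun hjk hij => (hmin j hij).not_gt hjk, fun hij => (not_lt.mp hij).trans_lt hk⟩
  have hkS : k ∈ S := by
    have hsplit := Finset.sum_filter_add_sum_filter_not Finset.univ (fun j => x i < x j) w
    rw [Finset.mem_filter_univ, hbelow]
    linarith
  exact (hmax k hkS).not_gt hk

/-- For `0 < t`, the function of `s` that is `0` up to `t / 2`, `1` from `t` on, and linear in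
between. Composed with `f`, it is a test function for the sets `{f ≥ t}` and `{f < t / 2}`. -/
noncomputable def ramp (t s : ℝ) : ℝ := max 0 (min 1 (2 * s / t - 1))

theorem ramp_eq_one {t s : ℝ} (ht : 0 < t) (h : t ≤ s) : ramp t s = 1 := by
  have : 1 ≤ 2 * s / t - 1 := by
    rw [le_sub_iff_add_le, le_div_iff₀ ht]
    linarith
  simp [ramp, this]

theorem ramp_eq_zero {t s : ℝ} (ht : 0 < t) (h : s ≤ t / 2) : ramp t s = 0 := by
  have : 2 * s / t - 1 ≤ 0 := by
    rw [sub_nonpos, div_le_one₀ ht]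
    linarith
  exact max_eq_left ((min_le_right _ _).trans this)

theorem monotone_ramp {t : ℝ} (ht : 0 < t) : Monotone (ramp t) := fun p q h => by
  unfold ramp
  gcongr

theorem ramp_sub_ramp_le {t p q : ℝ} (ht : 0 < t) (hpq : p ≤ q) :
    ramp t q - ramp t p ≤ 2 * (q - p) / t := by
  have hnonneg : 0 ≤ 2 * (q - p) / t := div_nonneg (by linarith) ht.le
  have hmin : min 1 (2 * q / t - 1) - min 1 (2 * p / t - 1) ≤ 2 * (q - p) / t := by
    have hdiff : 2 * q / t - 1 = 2 * p / t - 1 + 2 * (q - p) / t := by ring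
    rw [hdiff, sub_le_iff_le_add', ← min_add_add_right]
    exact min_le_min_right _ (by linarith)
  calc ramp t q - ramp t p
      ≤ max (0 - 0) (min 1 (2 * q / t - 1) - min 1 (2 * p / t - 1)) := max_sub_max_le_max _ _ _ _
    _ ≤ 2 * (q - p) / t := max_le (by simpa using hnonneg) hmin

theorem ramp_sub_ramp_le_div_right {t p q : ℝ} (ht : 0 < t) (hp : 0 ≤ p) (hpq : p ≤ q) :
    ramp t q - ramp t p ≤ 2 * (q - p) / q := by
  rcases le_total q t with hqt | htq
  · rcases (hp.trans hpq).eq_or_lt with rfl | hq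
    · simp [le_antisymm hpq hp]
    · exact (ramp_sub_ramp_le ht hpq).trans (by gcongr)
  rcases le_total t p with htp | hpt
  · rw [ramp_eq_one ht htq, ramp_eq_one ht htp, sub_self]
    exact div_nonneg (by linarith) (by linarith)
  calc ramp t q - ramp t p = ramp t t - ramp t p := by
        rw [ramp_eq_one ht htq, ramp_eq_one ht le_rfl]
    _ ≤ 2 * (t - p) / t := ramp_sub_ramp_le ht hpt
    _ = 2 * (1 - p / t) := by field_simp
    _ ≤ 2 * (1 - p / q) := by gcongr
    _ = 2 * (q - p) / q := by
      have : q ≠ 0 := by linarith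
      field_simp

theorem sq_ramp_sub_ramp_le {t p q : ℝ} (ht : 0 < t) (hp : 0 ≤ p) (hq : 0 ≤ q) :
    (ramp t p - ramp t q) ^ 2 ≤
      (Set.Ioc 0 (4 * max p q ^ 2)).indicator (fun _ => 4 * (p - q) ^ 2 / max p q ^ 2) (t ^ 2) := by
  wlog hpq : p ≤ q generalizing p q
  · simpa only [max_comm q p, sub_sq_comm q p, sub_sq_comm (ramp t q)] using
      this hq hp (le_of_not_ge hpq)
  rw [max_eq_right hpq]
  rcases lt_or_ge (2 * q) t with hlt | hge
  · rw [ramp_eq_zero ht (by linarith), ramp_eq_zero ht (by linarith), sub_self, sq, zero_mul]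
    exact Set.indicator_nonneg (fun _ _ => by positivity) _
  · have hmem : t ^ 2 ∈ Set.Ioc 0 (4 * q ^ 2) := ⟨by positivity, by nlinarith⟩
    rw [Set.indicator_of_mem hmem, sub_sq_comm]
    calc (ramp t q - ramp t p) ^ 2 ≤ (2 * (q - p) / q) ^ 2 :=
          pow_le_pow_left₀ (sub_nonneg.mpr (monotone_ramp ht hpq))
            (ramp_sub_ramp_le_div_right ht hp hpq) 2
      _ = 4 * (p - q) ^ 2 / q ^ 2 := by ring

section StepSum

open MeasureTheory

theorem exists_mem_lt_of_setIntegral_lt {α : Type*} [MeasurableSpace α]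
    {μ : Measure α} {s : Set α} {f g : α → ℝ} (hs : MeasurableSet s)
    (hf : IntegrableOn f s μ) (hg : IntegrableOn g s μ)
    (h : ∫ x in s, f x ∂μ < ∫ x in s, g x ∂μ) : ∃ x ∈ s, f x < g x := by
  by_contra! hle
  exact h.not_ge (setIntegral_mono_on hg hf hs hle)

variable {ι : Type*} [Fintype ι] {w a b : ι → ℝ}

/-- The step function of `τ` that is the sum of `w i` over the `i` with `a i < τ ≤ b i`. Volumes and
cuts of superlevel sets have this form, which makes their integrals over the level computable. -/
noncomputable def stepSum (w a b : ι → ℝ) (τ : ℝ) : ℝ :=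
  ∑ i, (Set.Ioc (a i) (b i)).indicator (fun _ => w i) τ

theorem integrable_stepSum : Integrable (stepSum w a b) := by
  refine integrable_finsetSum _ fun i _ => ?_
  exact (integrable_indicator_iff measurableSet_Ioc).mpr
    (integrableOn_const measure_Ioc_lt_top.ne)

theorem integral_stepSum (w a b : ι → ℝ) :
    ∫ τ, stepSum w a b τ = ∑ i, max (b i - a i) 0 * w i := by
  simp only [stepSum]
  rw [integral_finsetSum]
  · simp [integral_indicator_const]
  · exact fun i _ => (integrable_indicator_iff measurableSet_Ioc).mpr
      (integrableOn_const measure_Ioc_lt_top.ne)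

theorem setIntegral_Ioi_stepSum (w : ι → ℝ) (b : ι → ℝ) {c : ℝ} (ha : ∀ i, c ≤ a i) :
    ∫ τ in Set.Ioi c, stepSum w a b τ = ∑ i, max (b i - a i) 0 * w i := by
  rw [setIntegral_eq_integral_of_forall_compl_eq_zero, integral_stepSum]
  exact fun τ hτ => Finset.sum_eq_zero fun i _ => Set.indicator_of_notMem
    (fun hmem => hτ ((ha i).trans_lt hmem.1)) _

end StepSum

theorem submatrix_mulVec_add_submatrix_mulVec {l m n R : Type*} [Fintype n]
    [NonUnitalNonAssocSemiring R] (p : n → Prop) [Fintype {j // p j}] [Fintype {j // ¬p j}]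
    (A : Matrix l n R) (r : m → l) (x : n → R) :
    A.submatrix r (fun j : {j // p j} => j.1) *ᵥ (fun j => x j) +
      A.submatrix r (fun j : {j // ¬p j} => j.1) *ᵥ (fun j => x j) = fun i => (A *ᵥ x) (r i) := by
  classical
  ext i
  simp only [Pi.add_apply, Matrix.mulVec, dotProduct, Matrix.submatrix_apply]
  convert Fintype.sum_subtype_add_sum_subtype p fun j => A (r i) j * x j

theorem dotProduct_eq_sum_orthonormalBasis {ι n : Type*} [Fintype ι] [Fintype n]
    (b : OrthonormalBasis ι ℝ (EuclideanSpace ℝ n)) (z w : n → ℝ) :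
    z ⬝ᵥ w = ∑ i, ((b i).ofLp ⬝ᵥ z) * ((b i).ofLp ⬝ᵥ w) := by
  have hinner : ∀ x y : n → ℝ, x ⬝ᵥ y = inner ℝ (WithLp.toLp 2 y) (WithLp.toLp 2 x) := by
    intro x y
    simp [PiLp.inner_apply, dotProduct]
  rw [dotProduct_comm, hinner, ← b.sum_inner_mul_inner]
  refine Finset.sum_congr rfl fun i _ => ?_
  rw [hinner, dotProduct_comm, hinner]

theorem mul_dotProduct_self_le_of_orthogonal_ker {n : Type*} [Fintype n] [DecidableEq n]
    {N : Matrix n n ℝ} (hN : N.IsHermitian) {l : ℝ}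
    (hl : ∀ μ ≠ 0, Module.End.HasEigenvalue (Matrix.toLin' N) μ → l ≤ μ) {z : n → ℝ}
    (hz : ∀ w, N *ᵥ w = 0 → w ⬝ᵥ z = 0) : l * (z ⬝ᵥ z) ≤ z ⬝ᵥ N *ᵥ z := by
  let b := hN.eigenvectorBasis
  have hb : ∀ i, N *ᵥ (b i).ofLp = hN.eigenvalues i • (b i).ofLp := hN.mulVec_eigenvectorBasis
  have hcoeff : ∀ i, (b i).ofLp ⬝ᵥ N *ᵥ z = hN.eigenvalues i * ((b i).ofLp ⬝ᵥ z) := fun i => by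
    rw [Matrix.dotProduct_mulVec, ← Matrix.mulVec_transpose,
      ← Matrix.conjTranspose_eq_transpose_of_trivial, hN.eq, hb, smul_dotProduct, smul_eq_mul]
  rw [dotProduct_eq_sum_orthonormalBasis b z z, dotProduct_eq_sum_orthonormalBasis b z,
    Finset.mul_sum]
  refine Finset.sum_le_sum fun i _ => ?_
  rw [hcoeff, mul_left_comm _ (hN.eigenvalues i)]
  rcases eq_or_ne (hN.eigenvalues i) 0 with hi | hi
  · have hker : (b i).ofLp ⬝ᵥ z = 0 := hz _ (by rw [hb, hi, zero_smul])
    simp [hker]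
  · refine mul_le_mul_of_nonneg_right (hl _ hi ?_) (mul_self_nonneg _)
    refine Module.End.hasEigenvalue_of_hasEigenvector (x := (b i).ofLp) ⟨?_, fun h => ?_⟩
    · rw [Module.End.mem_eigenspace_iff, Matrix.toLin'_apply, hb]
    · exact b.orthonormal.ne_zero i (PiLp.ext fun v => congrFun h v)

namespace WeightedGraph

section Volume

variable {V : Type*} (G : WeightedGraph V)

theorem cut_comm (A B : Finset V) : G.cut A B = G.cut B A := by
  simp only [cut, Finset.sum_comm (s := A), G.symm]

theorem cut_nonneg (A B : Finset V) : 0 ≤ G.cut A B :=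
  Finset.sum_nonneg fun v _ => Finset.sum_nonneg fun u _ => G.nonneg v u

variable [Fintype V]

theorem deg_nonneg (v : V) : 0 ≤ G.deg v :=
  Finset.sum_nonneg fun u _ => G.nonneg v u

variable {G} in
theorem Connected.deg_pos [Nontrivial V] (hG : G.Connected) (v : V) : 0 < G.deg v := by
  obtain ⟨u, hu⟩ := hG.preconnected.exists_adj_of_nontrivial v
  exact Finset.sum_pos' (fun u _ => G.nonneg v u) ⟨u, Finset.mem_univ u, hu⟩

theorem vol_nonneg (A : Finset V) : 0 ≤ G.vol A :=
  Finset.sum_nonneg fun v _ => G.deg_nonneg v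

theorem vol_mono {A B : Finset V} (h : A ⊆ B) : G.vol A ≤ G.vol B :=
  Finset.sum_le_sum_of_subset_of_nonneg h fun v _ _ => G.deg_nonneg v

theorem cut_le_vol (A B : Finset V) : G.cut A B ≤ G.vol A :=
  Finset.sum_le_sum fun v _ =>
    Finset.sum_le_sum_of_subset_of_nonneg (Finset.subset_univ B) fun u _ _ => G.nonneg v u

variable {G} in
theorem nonempty_of_vol_pos {A : Finset V} (h : 0 < G.vol A) : A.Nonempty := by
  by_contra! hA
  simp [hA, vol] at h

theorem vol_add_vol_compl [DecidableEq V] (A : Finset V) :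
    G.vol A + G.vol Aᶜ = ∑ v, G.deg v :=
  Finset.sum_add_sum_compl A _

theorem cut_self_add_cut_compl [DecidableEq V] (A : Finset V) :
    G.cut A A + G.cut A Aᶜ = G.vol A := by
  simp only [cut, vol, deg, ← Finset.sum_add_distrib, Finset.sum_add_sum_compl]

/-- The squared norm `∑ v, c_v * y_v ^ 2` of the space `L²(deg)`, the denominator of the
Rayleigh quotient of the normalized Laplacian. -/
noncomputable def sqNorm (y : V → ℝ) : ℝ := ∑ v, G.deg v * y v ^ 2

theorem sqNorm_nonneg (y : V → ℝ) : 0 ≤ G.sqNorm y :=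
  Finset.sum_nonneg fun v _ => mul_nonneg (G.deg_nonneg v) (sq_nonneg _)

variable {G} in
theorem Connected.sqNorm_pos [Nontrivial V] (hG : G.Connected) {y : V → ℝ} (hy : y ≠ 0) :
    0 < G.sqNorm y := by
  obtain ⟨v, hv⟩ := Function.ne_iff.mp hy
  exact Finset.sum_pos' (fun v _ => mul_nonneg (G.deg_nonneg v) (sq_nonneg _))
    ⟨v, Finset.mem_univ v, mul_pos (hG.deg_pos v) (sq_pos_of_ne_zero hv)⟩

theorem sqNorm_posPart_add_sqNorm_negPart (y : V → ℝ) :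
    G.sqNorm y⁺ + G.sqNorm y⁻ = G.sqNorm y := by
  simp only [sqNorm, ← Finset.sum_add_distrib, ← mul_add]
  refine Finset.sum_congr rfl fun v _ => ?_
  rw [Pi.posPart_apply, Pi.negPart_apply]
  congr 1
  rcases le_total 0 (y v) with h | h <;> simp [h]

theorem vol_mul_sq_add_vol_mul_sq_le {A B : Finset V} (hd : Disjoint A B) {x : V → ℝ}
    {a b : ℝ} (hA : ∀ v ∈ A, x v = a) (hB : ∀ v ∈ B, x v = b) :
    G.vol A * a ^ 2 + G.vol B * b ^ 2 ≤ G.sqNorm x := by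
  classical
  calc G.vol A * a ^ 2 + G.vol B * b ^ 2 = ∑ v ∈ A ∪ B, G.deg v * x v ^ 2 := by
        rw [Finset.sum_union hd, vol, vol, Finset.sum_mul, Finset.sum_mul]
        congr 1
        · exact Finset.sum_congr rfl fun v hv => by rw [hA v hv]
        · exact Finset.sum_congr rfl fun v hv => by rw [hB v hv]
    _ ≤ G.sqNorm x := Finset.sum_le_sum_of_subset_of_nonneg (Finset.subset_univ _) fun v _ _ =>
        mul_nonneg (G.deg_nonneg v) (sq_nonneg _)

end Volume

section Energy

variable {V : Type*} [Fintype V] [DecidableEq V] (G : WeightedGraph V)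

/-- The Dirichlet energy `xᵀ L x`, i.e. half the sum of `c_{vu} * (x_v - x_u) ^ 2` over all ordered
pairs (see `two_mul_energy`). -/
noncomputable def energy (x : V → ℝ) : ℝ := x ⬝ᵥ G.laplacian *ᵥ x

theorem two_mul_energy (x : V → ℝ) :
    2 * G.energy x = ∑ v, ∑ u, G.c v u * (x v - x u) ^ 2 := by
  simp only [energy, dotProduct, sum_mul_laplacian, sq]

theorem energy_nonneg (x : V → ℝ) : 0 ≤ G.energy x := by
  refine nonneg_of_mul_nonneg_right (a := 2) ?_ two_pos
  rw [two_mul_energy]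
  exact Finset.sum_nonneg fun v _ => Finset.sum_nonneg fun u _ =>
    mul_nonneg (G.nonneg v u) (sq_nonneg _)

variable {G} in
theorem Connected.eq_of_energy_nonpos (hG : G.Connected) {x : V → ℝ} (h : G.energy x ≤ 0)
    (u v : V) : x u = x v := by
  have hflat := G.energy_eq_zero x (by rw [← two_mul_energy]; linarith)
  obtain ⟨p⟩ := hG.preconnected u v
  induction p with
  | nil => rfl
  | cons hadj _ ih =>
    exact (sub_eq_zero.mp ((mul_eq_zero.mp (hflat _ _)).resolve_left (ne_of_gt hadj))).trans ih

theorem energy_smul (a : ℝ) (x : V → ℝ) : G.energy (a • x) = a ^ 2 * G.energy x := by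
  simp only [energy, Matrix.mulVec_smul, smul_dotProduct, dotProduct_smul, smul_eq_mul]
  ring

theorem energy_sub_const (x : V → ℝ) (t : ℝ) : G.energy (fun v => x v - t) = G.energy x := by
  have := G.two_mul_energy (fun v => x v - t)
  simp only [sub_sub_sub_cancel_right, ← two_mul_energy] at this
  linarith

theorem energy_single (v : V) : G.energy (Pi.single v 1) = G.deg v := by
  simp [energy, laplacian, G.loopless v]

theorem energy_indicator (A : Finset V) :
    G.energy (fun v => if v ∈ A then 1 else 0) = G.cut A Aᶜ := by
  simp only [energy, dotProduct, laplacian_mulVec, cut, ← Finset.sum_add_sum_compl A]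
  rw [Finset.sum_eq_zero (s := Aᶜ) fun v hv => by simp [Finset.mem_compl.mp hv], add_zero]
  refine Finset.sum_congr rfl fun v hv => ?_
  rw [Finset.sum_eq_zero (s := A) fun u hu => by simp [hv, hu], zero_add, if_pos hv, one_mul]
  exact Finset.sum_congr rfl fun u hu => by simp [Finset.mem_compl.mp hu]

theorem energy_posPart_add_energy_negPart_le (x : V → ℝ) :
    G.energy x⁺ + G.energy x⁻ ≤ G.energy x := by
  have hpt : ∀ a b : ℝ, (a⁺ - b⁺) ^ 2 + (a⁻ - b⁻) ^ 2 ≤ (a - b) ^ 2 := by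
    intro a b
    rcases le_total 0 a with ha | ha <;> rcases le_total 0 b with hb | hb <;>
      simp [ha, hb] <;> nlinarith
  refine le_of_mul_le_mul_left ?_ (two_pos (α := ℝ))
  simp only [mul_add, two_mul_energy, ← Finset.sum_add_distrib]
  refine Finset.sum_le_sum fun v _ => Finset.sum_le_sum fun u _ => ?_
  rw [← mul_add]
  exact mul_le_mul_of_nonneg_left (hpt (x v) (x u)) (G.nonneg v u)

theorem energy_le_of_harmonic {X : Finset V} {h x : V → ℝ}
    (hharm : ∀ v ∉ X, (G.laplacian *ᵥ h) v = 0) (hX : ∀ v ∈ X, x v = h v) :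
    G.energy h ≤ G.energy x := by
  have horth : (x - h) ⬝ᵥ G.laplacian *ᵥ h = 0 := by
    refine Finset.sum_eq_zero fun v _ => ?_
    by_cases hv : v ∈ X
    · simp [hX v hv]
    · simp [hharm v hv]
  have hcomm : h ⬝ᵥ G.laplacian *ᵥ (x - h) = (x - h) ⬝ᵥ G.laplacian *ᵥ h := by
    rw [Matrix.dotProduct_mulVec, ← Matrix.mulVec_transpose, laplacian_symm, dotProduct_comm]
  calc G.energy h ≤ G.energy h + G.energy (x - h) := le_add_of_nonneg_right (G.energy_nonneg _)
    _ = G.energy (h + (x - h)) := by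
      simp only [energy, Matrix.mulVec_add, add_dotProduct, dotProduct_add, hcomm, horth]
      ring
    _ = G.energy x := by rw [add_sub_cancel]

end Energy

section Schur

variable {V : Type*} [Fintype V] [DecidableEq V] {G : WeightedGraph V}

variable (G) in
/-- The extension of `g : X → ℝ` to `V` that is harmonic off `X`, namely
`- L[Xᶜ, Xᶜ]⁻¹ L[Xᶜ, X] g` on the complement of `X`. -/
noncomputable def harmonicExtension (X : Finset V) (g : {v // v ∈ X} → ℝ) (v : V) : ℝ :=
  if hv : v ∈ X then g ⟨v, hv⟩
  else -((G.laplacian.submatrix (fun v : {v // v ∉ X} => v.1)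
      (fun v : {v // v ∉ X} => v.1))⁻¹ *ᵥ
    (G.laplacian.submatrix (fun v : {v // v ∉ X} => v.1) (fun v : {v // v ∈ X} => v.1) *ᵥ g))
      ⟨v, hv⟩

theorem harmonicExtension_of_mem {X : Finset V} (g : {v // v ∈ X} → ℝ) {v : V} (hv : v ∈ X) :
    G.harmonicExtension X g v = g ⟨v, hv⟩ :=
  dif_pos hv

theorem laplacian_mulVec_harmonicExtension {ι : Type*} (X : Finset V) (g : {v // v ∈ X} → ℝ)
    (r : ι → V) :
    (fun i => (G.laplacian *ᵥ G.harmonicExtension X g) (r i)) =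
      G.laplacian.submatrix r (fun v : {v // v ∈ X} => v.1) *ᵥ g -
        G.laplacian.submatrix r (fun v : {v // v ∉ X} => v.1) *ᵥ
          (G.laplacian.submatrix (fun v : {v // v ∉ X} => v.1)
            (fun v : {v // v ∉ X} => v.1))⁻¹ *ᵥ
          G.laplacian.submatrix (fun v : {v // v ∉ X} => v.1)
            (fun v : {v // v ∈ X} => v.1) *ᵥ g := by
  rw [← submatrix_mulVec_add_submatrix_mulVec (· ∈ X), sub_eq_add_neg, ← Matrix.mulVec_neg]
  congr 2 <;> ext v <;> simp [harmonicExtension, v.2]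

theorem Connected.laplacian_mulVec_harmonicExtension_of_notMem (hG : G.Connected)
    {X : Finset V} (hX : X.Nonempty) (g : {v // v ∈ X} → ℝ) {v : V} (hv : v ∉ X) :
    (G.laplacian *ᵥ G.harmonicExtension X g) v = 0 := by
  have hblock := congrFun
    (G.laplacian_mulVec_harmonicExtension X g fun v : {v // v ∉ X} => v.1) ⟨v, hv⟩
  rwa [Matrix.mulVec_mulVec, Matrix.mul_nonsing_inv _ (G.isUnit_det_submatrix hG hX),
    Matrix.one_mulVec, sub_self] at hblock

theorem Connected.laplacian_mulVec_harmonicExtension_of_mem (hG : G.Connected) {X : Finset V}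
    (g : {v // v ∈ X} → ℝ) (v : {v // v ∈ X}) :
    (G.laplacian *ᵥ G.harmonicExtension X g) v = ((G.schur X).laplacian *ᵥ g) v := by
  have hblock := G.laplacian_mulVec_harmonicExtension X g fun v : {v // v ∈ X} => v.1
  rw [G.laplacian_schur hG ⟨v, v.2⟩, schurMatrix, Matrix.sub_mulVec, ← Matrix.mulVec_mulVec,
    ← Matrix.mulVec_mulVec, ← hblock]

theorem Connected.energy_harmonicExtension (hG : G.Connected) {X : Finset V} (hX : X.Nonempty)
    (g : {v // v ∈ X} → ℝ) :
    G.energy (G.harmonicExtension X g) = (G.schur X).energy g := by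
  calc G.energy (G.harmonicExtension X g)
      = ∑ v ∈ X, G.harmonicExtension X g v * (G.laplacian *ᵥ G.harmonicExtension X g) v :=
        (Finset.sum_subset X.subset_univ fun v _ hv => by
          rw [hG.laplacian_mulVec_harmonicExtension_of_notMem hX g hv, mul_zero]).symm
    _ = (G.schur X).energy g := by
      rw [← Finset.sum_coe_sort]
      refine Finset.sum_congr rfl fun v _ => ?_
      rw [hG.laplacian_mulVec_harmonicExtension_of_mem, harmonicExtension_of_mem g v.2]

theorem Connected.schur_energy_le (hG : G.Connected) {X : Finset V} (hX : X.Nonempty)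
    (x : V → ℝ) : (G.schur X).energy (fun v => x v) ≤ G.energy x := by
  rw [← hG.energy_harmonicExtension hX]
  exact G.energy_le_of_harmonic
    (fun _ => hG.laplacian_mulVec_harmonicExtension_of_notMem hX _)
    fun v hv => (harmonicExtension_of_mem (fun v => x v) hv).symm

theorem Connected.schur_deg_le (hG : G.Connected) {X : Finset V} (v : {v // v ∈ X}) :
    (G.schur X).deg v ≤ G.deg v := by
  have hsingle : Pi.single v 1 =
      fun u : {v // v ∈ X} => (Pi.single v.1 1 : V → ℝ) u := by
    ext u
    simp only [Pi.single_apply, Subtype.ext_iff]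
  rw [← energy_single, ← energy_single, hsingle]
  exact hG.schur_energy_le ⟨v, v.2⟩ _

variable (G) in
theorem le_schur_c {X : Finset V} (u v : {v // v ∈ X}) : G.c u v ≤ (G.schur X).c u v := by
  by_cases huv : u = v
  · simp [huv, schur, G.loopless]
  have hL : G.laplacian u v = -G.c u v := by
    simp [laplacian, Subtype.coe_injective.ne huv]
  have hcorr : 0 ≤ (G.laplacian.submatrix (fun v : {v // v ∈ X} => v.1)
        (fun v : {v // v ∉ X} => v.1) *
      (G.laplacian.submatrix (fun v : {v // v ∉ X} => v.1) (fun v : {v // v ∉ X} => v.1))⁻¹ *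
      G.laplacian.submatrix (fun v : {v // v ∉ X} => v.1) (fun v : {v // v ∈ X} => v.1)) u v := by
    refine Finset.sum_nonneg fun j _ => mul_nonneg_of_nonpos_of_nonpos
      (Finset.sum_nonpos fun i _ => mul_nonpos_of_nonpos_of_nonneg ?_
        (G.inv_submatrix_nonneg X i j)) ?_
    · exact G.laplacian_nonpos (ne_of_mem_of_not_mem u.2 i.2)
    · exact G.laplacian_nonpos (ne_of_mem_of_not_mem v.2 j.2).symm
  simp only [schur, huv, if_false, schurMatrix, Matrix.sub_apply, Matrix.submatrix_apply, hL]
  linarith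

variable (G) in
/-- `c^I(A, B)` for the graph `I = Schur(G, A ∪ B)`. -/
noncomputable def schurCut (A B : Finset V) : ℝ :=
  (G.schur (A ∪ B)).cut (A.subtype (· ∈ A ∪ B)) (B.subtype (· ∈ A ∪ B))

variable (G) in
/-- `vol_I(A)` for the graph `I = Schur(G, X)`, where `A ⊆ X`. -/
noncomputable def schurVol (X A : Finset V) : ℝ := (G.schur X).vol (A.subtype (· ∈ X))

theorem schurConductance_eq (A B : Finset V) : G.schurConductance A B =
    G.schurCut A B / min (G.schurVol (A ∪ B) A) (G.schurVol (A ∪ B) B) :=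
  rfl

theorem Connected.schurVol_le_vol (hG : G.Connected) {A X : Finset V} (h : A ⊆ X) :
    G.schurVol X A ≤ G.vol A := by
  rw [vol, ← Finset.sum_subtype_of_mem _ h]
  exact Finset.sum_le_sum fun v _ => hG.schur_deg_le v

variable (G) in
theorem cut_self_le_schurVol {A X : Finset V} (h : A ⊆ X) : G.cut A A ≤ G.schurVol X A := by
  have hsum : ∀ f : V → ℝ, ∑ v ∈ A, f v = ∑ v ∈ A.subtype (· ∈ X), f v := fun f =>
    (Finset.sum_subtype_of_mem f h).symm
  calc G.cut A A
      ≤ (G.schur X).cut (A.subtype (· ∈ X)) (A.subtype (· ∈ X)) := by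
        simp only [cut, hsum]
        exact Finset.sum_le_sum fun v _ => Finset.sum_le_sum fun u _ => G.le_schur_c v u
    _ ≤ G.schurVol X A := cut_le_vol _ _ _

theorem schurCut_eq_energy {A B : Finset V} (hd : Disjoint A B) :
    G.schurCut A B = (G.schur (A ∪ B)).energy (fun v => if v.1 ∈ A then 1 else 0) := by
  have hcompl : (A.subtype (· ∈ A ∪ B))ᶜ = B.subtype (· ∈ A ∪ B) := by
    ext v
    have := v.2
    simp only [Finset.mem_compl, Finset.mem_subtype, Finset.mem_union] at this ⊢
    exact ⟨this.resolve_left, fun hB hA => Finset.disjoint_left.mp hd hA hB⟩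
  rw [schurCut, ← hcompl, ← energy_indicator]
  simp only [Finset.mem_subtype]

theorem Connected.exists_energy_eq_schurCut (hG : G.Connected) {A B : Finset V}
    (hA : A.Nonempty) (hd : Disjoint A B) :
    ∃ x : V → ℝ, (∀ v ∈ A, x v = 1) ∧ (∀ v ∈ B, x v = 0) ∧ G.energy x = G.schurCut A B := by
  refine ⟨G.harmonicExtension (A ∪ B) fun v => if v.1 ∈ A then 1 else 0, fun v hv => ?_,
    fun v hv => ?_, ?_⟩
  · rw [harmonicExtension_of_mem _ (Finset.mem_union_left B hv), if_pos hv]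
  · rw [harmonicExtension_of_mem _ (Finset.mem_union_right A hv),
      if_neg (Finset.disjoint_right.mp hd hv)]
  · rw [hG.energy_harmonicExtension (hA.mono Finset.subset_union_left), schurCut_eq_energy hd]

theorem Connected.schurCut_le_energy (hG : G.Connected) {A B : Finset V} (hA : A.Nonempty)
    (hd : Disjoint A B) {x : V → ℝ} (h1 : ∀ v ∈ A, x v = 1) (h0 : ∀ v ∈ B, x v = 0) :
    G.schurCut A B ≤ G.energy x := by
  have hx : (fun v : {v // v ∈ A ∪ B} => if v.1 ∈ A then (1 : ℝ) else 0) =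
      fun v : {v // v ∈ A ∪ B} => x v := by
    ext v
    split_ifs with hv
    · exact (h1 v hv).symm
    · exact (h0 v ((Finset.mem_union.mp v.2).resolve_left hv)).symm
  rw [schurCut_eq_energy hd, hx]
  exact hG.schur_energy_le (hA.mono Finset.subset_union_left) x

theorem Connected.schurCut_pos (hG : G.Connected) {A B : Finset V} (hA : A.Nonempty)
    (hB : B.Nonempty) (hd : Disjoint A B) : 0 < G.schurCut A B := by
  obtain ⟨x, h1, h0, hE⟩ := hG.exists_energy_eq_schurCut hA hd
  obtain ⟨⟨a, ha⟩, b, hb⟩ := And.intro hA hB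
  by_contra! hle
  have hab := hG.eq_of_energy_nonpos (hE.trans_le hle) a b
  rw [h1 a ha, h0 b hb] at hab
  exact one_ne_zero hab

variable (G) in
theorem schurCut_le_min_schurVol (A B : Finset V) :
    G.schurCut A B ≤ min (G.schurVol (A ∪ B) A) (G.schurVol (A ∪ B) B) :=
  le_min (cut_le_vol _ _ _) ((cut_comm _ _ _).trans_le (cut_le_vol _ _ _))

variable (G) in
theorem schurConductance_le_one (A B : Finset V) : G.schurConductance A B ≤ 1 :=
  div_le_one_of_le₀ (G.schurCut_le_min_schurVol A B)
    ((cut_nonneg _ _ _).trans (G.schurCut_le_min_schurVol A B))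

variable (G) in
theorem isLeast_minSchurConductance [Nontrivial V] :
    IsLeast G.schurConductances G.minSchurConductance := by
  have hfin : G.schurConductances.Finite := by
    refine (Set.finite_range fun p : Finset V × Finset V => G.schurConductance p.1 p.2).subset ?_
    rintro r ⟨A, B, -, -, -, rfl⟩
    exact ⟨(A, B), rfl⟩
  have hne : G.schurConductances.Nonempty := by
    obtain ⟨u, v, huv⟩ := exists_pair_ne V
    exact ⟨_, {u}, {v}, Finset.singleton_nonempty u, Finset.singleton_nonempty v,
      Finset.disjoint_singleton.mpr huv, rfl⟩
  exact ⟨hne.csInf_mem hfin, fun r hr => csInf_le hfin.bddBelow hr⟩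

end Schur

section Spectral

variable {V : Type*} [Fintype V] {G : WeightedGraph V}

variable (G) in
theorem isHermitian_normLaplacian [DecidableEq V] : G.normLaplacian.IsHermitian := by
  simp [Matrix.IsHermitian, normLaplacian, Matrix.mul_assoc,
    Matrix.conjTranspose_eq_transpose_of_trivial, laplacian_symm]

variable (G) in
/-- The vector `D^{1/2} y`. This change of variables turns the normalized Laplacian into the
Laplacian and the Euclidean norm into that of `L²(deg)`. -/
noncomputable def sqrtDegMul (y : V → ℝ) (v : V) : ℝ := √(G.deg v) * y v

theorem sqrtDegMul_dotProduct_sqrtDegMul (x y : V → ℝ) :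
    G.sqrtDegMul x ⬝ᵥ G.sqrtDegMul y = ∑ v, G.deg v * (x v * y v) :=
  Finset.sum_congr rfl fun v _ => by
    rw [sqrtDegMul, sqrtDegMul, mul_mul_mul_comm, Real.mul_self_sqrt (G.deg_nonneg v)]

variable [Nontrivial V]

theorem Connected.surjective_sqrtDegMul (hG : G.Connected) :
    Function.Surjective G.sqrtDegMul := fun z =>
  ⟨fun v => z v / √(G.deg v), funext fun v =>
    mul_div_cancel₀ _ (Real.sqrt_pos.mpr (hG.deg_pos v)).ne'⟩

variable [DecidableEq V]

theorem Connected.normLaplacian_mulVec_sqrtDegMul (hG : G.Connected) (y : V → ℝ) (v : V) :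
    (G.normLaplacian *ᵥ G.sqrtDegMul y) v = (√(G.deg v))⁻¹ * (G.laplacian *ᵥ y) v := by
  have hy : Matrix.diagonal (fun v => (√(G.deg v))⁻¹) *ᵥ G.sqrtDegMul y = y := by
    ext u
    rw [Matrix.mulVec_diagonal, sqrtDegMul,
      inv_mul_cancel_left₀ (Real.sqrt_pos.mpr (hG.deg_pos u)).ne']
  rw [normLaplacian, ← Matrix.mulVec_mulVec, ← Matrix.mulVec_mulVec, hy, Matrix.mulVec_diagonal]

theorem Connected.sqrtDegMul_dotProduct_normLaplacian (hG : G.Connected) (y : V → ℝ) :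
    G.sqrtDegMul y ⬝ᵥ G.normLaplacian *ᵥ G.sqrtDegMul y = G.energy y :=
  Finset.sum_congr rfl fun v _ => by
    rw [hG.normLaplacian_mulVec_sqrtDegMul, sqrtDegMul, mul_mul_mul_comm,
      mul_inv_cancel₀ (Real.sqrt_pos.mpr (hG.deg_pos v)).ne', one_mul]

theorem Connected.laplacian_mulVec_of_normLaplacian_eigenvector (hG : G.Connected)
    {y : V → ℝ} {μ : ℝ} (hy : G.normLaplacian *ᵥ G.sqrtDegMul y = μ • G.sqrtDegMul y) (v : V) :
    (G.laplacian *ᵥ y) v = μ * (G.deg v * y v) := by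
  have hs : √(G.deg v) ≠ 0 := (Real.sqrt_pos.mpr (hG.deg_pos v)).ne'
  have hv := congrFun hy v
  rw [hG.normLaplacian_mulVec_sqrtDegMul, inv_mul_eq_iff_eq_mul₀ hs] at hv
  rw [hv, Pi.smul_apply, smul_eq_mul, sqrtDegMul, mul_left_comm, ← mul_assoc √(G.deg v),
    Real.mul_self_sqrt (G.deg_nonneg v)]

theorem Connected.exists_eigenfunction (hG : G.Connected) {μ : ℝ}
    (hμ : μ ∈ G.nonzeroEigenvalues) :
    ∃ y : V → ℝ, y ≠ 0 ∧ ∑ v, G.deg v * y v = 0 ∧ G.energy y = μ * G.sqNorm y := by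
  obtain ⟨z, hz, hz0⟩ := hμ.2.exists_hasEigenvector
  obtain ⟨y, rfl⟩ := hG.surjective_sqrtDegMul z
  rw [Module.End.mem_eigenspace_iff, Matrix.toLin'_apply] at hz
  have hL := hG.laplacian_mulVec_of_normLaplacian_eigenvector hz
  refine ⟨y, ?_, ?_, ?_⟩
  · rintro rfl
    exact hz0 (funext fun v => mul_zero _)
  · have hsum : ∑ v, (G.laplacian *ᵥ y) v = 0 := by simpa using G.sum_mul_laplacian (fun _ => 1) y
    simp only [hL, ← Finset.mul_sum] at hsum
    exact (mul_eq_zero.mp hsum).resolve_left hμ.1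
  · simp only [energy, dotProduct, sqNorm, hL, Finset.mul_sum]
    exact Finset.sum_congr rfl fun v _ => by ring

theorem Connected.pos_of_mem_nonzeroEigenvalues (hG : G.Connected) {μ : ℝ}
    (hμ : μ ∈ G.nonzeroEigenvalues) : 0 < μ := by
  obtain ⟨y, hy0, -, hE⟩ := hG.exists_eigenfunction hμ
  have hnonneg : 0 ≤ μ * G.sqNorm y := hE ▸ G.energy_nonneg y
  exact (nonneg_of_mul_nonneg_left hnonneg (hG.sqNorm_pos hy0)).lt_of_ne' hμ.1

theorem Connected.nonempty_nonzeroEigenvalues (hG : G.Connected) :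
    G.nonzeroEigenvalues.Nonempty := by
  obtain ⟨v⟩ : Nonempty V := inferInstance
  have hN : G.normLaplacian ≠ 0 := fun h => by
    have hE := hG.sqrtDegMul_dotProduct_normLaplacian (Pi.single v 1)
    rw [h, Matrix.zero_mulVec, dotProduct_zero, energy_single] at hE
    exact (hG.deg_pos v).ne hE
  obtain ⟨z, μ, hμ, hz, hNz⟩ := G.isHermitian_normLaplacian.exists_eigenvector_of_ne_zero hN
  exact ⟨μ, hμ, Module.End.hasEigenvalue_of_hasEigenvector
    ⟨Module.End.mem_eigenspace_iff.mpr hNz, hz⟩⟩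

theorem Connected.isLeast_spectralGap (hG : G.Connected) :
    IsLeast G.nonzeroEigenvalues G.spectralGap := by
  have hfin : G.nonzeroEigenvalues.Finite :=
    (Module.End.finite_hasEigenvalue (Matrix.toLin' G.normLaplacian)).subset fun _ h => h.2
  exact ⟨hG.nonempty_nonzeroEigenvalues.csInf_mem hfin, fun _ h => csInf_le hfin.bddBelow h⟩

theorem Connected.spectralGap_pos (hG : G.Connected) : 0 < G.spectralGap :=
  hG.pos_of_mem_nonzeroEigenvalues hG.isLeast_spectralGap.1

theorem Connected.spectralGap_mul_sqNorm_le_energy (hG : G.Connected) {y : V → ℝ}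
    (hy : ∑ v, G.deg v * y v = 0) : G.spectralGap * G.sqNorm y ≤ G.energy y := by
  have hker : ∀ w, G.normLaplacian *ᵥ w = 0 → w ⬝ᵥ G.sqrtDegMul y = 0 := by
    intro w hw
    obtain ⟨x, rfl⟩ := hG.surjective_sqrtDegMul w
    have hE : G.energy x = 0 := by
      rw [← hG.sqrtDegMul_dotProduct_normLaplacian, hw, dotProduct_zero]
    obtain ⟨v₀⟩ : Nonempty V := inferInstance
    have hconst : ∀ v, x v = x v₀ := fun v => hG.eq_of_energy_nonpos hE.le v v₀
    simp only [sqrtDegMul_dotProduct_sqrtDegMul, hconst, mul_left_comm, ← Finset.mul_sum, hy,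
      mul_zero]
  have hnorm : G.sqrtDegMul y ⬝ᵥ G.sqrtDegMul y = G.sqNorm y := by
    simp only [sqrtDegMul_dotProduct_sqrtDegMul, sqNorm, sq]
  rw [← hnorm, ← hG.sqrtDegMul_dotProduct_normLaplacian]
  exact mul_dotProduct_self_le_of_orthogonal_ker G.isHermitian_normLaplacian
    (fun μ hμ h => hG.isLeast_spectralGap.2 ⟨hμ, h⟩) hker

theorem Connected.exists_spectralGap_mul_sqNorm_sub_le_energy (hG : G.Connected) (x : V → ℝ) :
    ∃ t : ℝ, G.spectralGap * G.sqNorm (fun v => x v - t) ≤ G.energy x := by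
  have hvol : 0 < ∑ v, G.deg v :=
    Finset.sum_pos (fun v _ => hG.deg_pos v) Finset.univ_nonempty
  let t := (∑ v, G.deg v * x v) / ∑ v, G.deg v
  have hmean : ∑ v, G.deg v * (x v - t) = 0 := by
    simp only [mul_sub, Finset.sum_sub_distrib, ← Finset.sum_mul, t]
    rw [mul_div_cancel₀ _ hvol.ne', sub_self]
  exact ⟨t, (hG.spectralGap_mul_sqNorm_le_energy hmean).trans_eq (G.energy_sub_const x t)⟩

theorem Connected.spectralGap_div_two_le_schurConductance (hG : G.Connected) {A B : Finset V}
    (hA : A.Nonempty) (hB : B.Nonempty) (hd : Disjoint A B) :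
    G.spectralGap / 2 ≤ G.schurConductance A B := by
  obtain ⟨x, h1, h0, hE⟩ := hG.exists_energy_eq_schurCut hA hd
  obtain ⟨t, ht⟩ := hG.exists_spectralGap_mul_sqNorm_sub_le_energy x
  have hnorm := G.vol_mul_sq_add_vol_mul_sq_le hd (x := fun v => x v - t) (a := 1 - t) (b := - t)
    (fun v hv => by rw [h1 v hv]) (fun v hv => by rw [h0 v hv, zero_sub])
  rw [schurConductance_eq]
  set m := min (G.schurVol (A ∪ B) A) (G.schurVol (A ∪ B) B)
  have hm0 : 0 < m := (hG.schurCut_pos hA hB hd).trans_le (G.schurCut_le_min_schurVol A B)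
  have hmA : m ≤ G.vol A :=
    (min_le_left _ _).trans (hG.schurVol_le_vol Finset.subset_union_left)
  have hmB : m ≤ G.vol B :=
    (min_le_right _ _).trans (hG.schurVol_le_vol Finset.subset_union_right)
  have hhalf : m / 2 ≤ G.sqNorm fun v => x v - t := by
    calc m / 2
        ≤ m * (1 - t) ^ 2 + m * (-t) ^ 2 := by
          nlinarith [mul_nonneg hm0.le (sq_nonneg (2 * t - 1))]
      _ ≤ G.vol A * (1 - t) ^ 2 + G.vol B * (-t) ^ 2 := by gcongr
      _ ≤ _ := hnorm
  rw [le_div_iff₀ hm0]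
  calc G.spectralGap / 2 * m = G.spectralGap * (m / 2) := by ring
    _ ≤ G.spectralGap * G.sqNorm (fun v => x v - t) :=
      mul_le_mul_of_nonneg_left hhalf hG.spectralGap_pos.le
    _ ≤ G.schurCut A B := ht.trans_eq hE

end Spectral

section Sweep

open MeasureTheory

variable {V : Type*} [Fintype V] (G : WeightedGraph V)

/-- The superlevel set `{f ≥ t}`, whose volume and cuts are studied as `t` varies. -/
noncomputable def superlevel (f : V → ℝ) (t : ℝ) : Finset V := {v | t ≤ f v}

theorem mem_superlevel {f : V → ℝ} {t : ℝ} {v : V} : v ∈ superlevel f t ↔ t ≤ f v :=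
  Finset.mem_filter_univ v

theorem superlevel_smul {a : ℝ} (ha : 0 < a) (f : V → ℝ) (t : ℝ) :
    superlevel (a • f) t = superlevel f (t / a) := by
  ext v
  rw [mem_superlevel, mem_superlevel, div_le_iff₀' ha, Pi.smul_apply, smul_eq_mul]

theorem vol_superlevel_sqrt {f : V → ℝ} (hf : 0 ≤ f) {τ : ℝ} (hτ : 0 < τ) :
    G.vol (superlevel f √τ) = stepSum G.deg 0 (fun v => f v ^ 2) τ := by
  rw [vol, superlevel, Finset.sum_filter]
  simp only [stepSum, Set.indicator_apply, Set.mem_Ioc, Pi.zero_apply, hτ, true_and,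
    Real.sqrt_le_left (hf _)]

theorem integrableOn_vol_superlevel_sqrt {f : V → ℝ} (hf : 0 ≤ f) :
    IntegrableOn (fun τ => G.vol (superlevel f √τ)) (Set.Ioi 0) :=
  integrable_stepSum.integrableOn.congr_fun (fun _ hτ => (G.vol_superlevel_sqrt hf hτ).symm)
    measurableSet_Ioi

theorem integral_vol_superlevel_sqrt {f : V → ℝ} (hf : 0 ≤ f) :
    ∫ τ in Set.Ioi 0, G.vol (superlevel f √τ) = G.sqNorm f := by
  rw [setIntegral_congr_fun measurableSet_Ioi
    fun _ hτ => G.vol_superlevel_sqrt hf hτ,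
    setIntegral_Ioi_stepSum (a := 0) (c := 0) _ _ fun _ => le_rfl]
  refine Finset.sum_congr rfl fun v _ => ?_
  rw [Pi.zero_apply, sub_zero, max_eq_left (sq_nonneg _), mul_comm]

theorem sum_c_mul_sq_add_sq (f : V → ℝ) :
    ∑ p : V × V, G.c p.1 p.2 * (f p.1 ^ 2 + f p.2 ^ 2) = 2 * G.sqNorm f := by
  simp only [mul_add, Finset.sum_add_distrib, two_mul, sqNorm, deg, Finset.sum_mul,
    Fintype.sum_prod_type]
  congr 1
  rw [Finset.sum_comm]
  simp only [G.symm]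

/-- An upper bound for the energy of `ramp √τ ∘ f` as a function of `τ > 0`, chosen to be a step
function so that its integral is computable. -/
noncomputable def rampMajorant (f : V → ℝ) : ℝ → ℝ :=
  stepSum (fun p : V × V => G.c p.1 p.2 * (2 * (f p.1 - f p.2) ^ 2 / max (f p.1) (f p.2) ^ 2)) 0
    (fun p => 4 * max (f p.1) (f p.2) ^ 2)

theorem integrable_rampMajorant (f : V → ℝ) : Integrable (G.rampMajorant f) :=
  integrable_stepSum

variable [DecidableEq V]

theorem cut_superlevel_sqrt {f : V → ℝ} (hf : 0 ≤ f) (τ : ℝ) :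
    G.cut (superlevel f √τ) (superlevel f √τ)ᶜ =
      stepSum (fun p : V × V => G.c p.1 p.2) (fun p => f p.2 ^ 2) (fun p => f p.1 ^ 2) τ := by
  simp only [cut, superlevel, Finset.compl_filter, Finset.sum_filter, stepSum,
    Fintype.sum_prod_type, Set.indicator_apply, Set.mem_Ioc, not_le, Real.sqrt_le_left (hf _)]
  refine Finset.sum_congr rfl fun v _ => ?_
  split_ifs with hv <;> simp [hv]

theorem integrableOn_cut_superlevel_sqrt {f : V → ℝ} (hf : 0 ≤ f) :
    IntegrableOn (fun τ => G.cut (superlevel f √τ) (superlevel f √τ)ᶜ)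
      (Set.Ioi 0) :=
  integrable_stepSum.integrableOn.congr_fun (fun τ _ => (G.cut_superlevel_sqrt hf τ).symm)
    measurableSet_Ioi

theorem two_mul_integral_cut_superlevel_sqrt {f : V → ℝ} (hf : 0 ≤ f) :
    2 * ∫ τ in Set.Ioi 0, G.cut (superlevel f √τ) (superlevel f √τ)ᶜ =
      ∑ p : V × V, G.c p.1 p.2 * |f p.1 ^ 2 - f p.2 ^ 2| := by
  simp only [G.cut_superlevel_sqrt hf]
  rw [setIntegral_Ioi_stepSum _ _ fun _ => sq_nonneg _, two_mul]
  nth_rewrite 2 [← Equiv.sum_comp (Equiv.prodComm V V)]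
  rw [← Finset.sum_add_distrib]
  refine Finset.sum_congr rfl fun p _ => ?_
  simp only [Equiv.prodComm_apply, Prod.fst_swap, Prod.snd_swap, G.symm p.2 p.1]
  rw [← add_mul, mul_comm, ← max_zero_add_max_neg_zero_eq_abs_self, neg_sub]

theorem sq_integral_cut_superlevel_sqrt_le {f : V → ℝ} (hf : 0 ≤ f) :
    (∫ τ in Set.Ioi 0, G.cut (superlevel f √τ) (superlevel f √τ)ᶜ) ^ 2 ≤
      2 * G.energy f * G.sqNorm f := by
  -- Cauchy–Schwarz for `|f u ^ 2 - f v ^ 2| = |f u - f v| * |f u + f v|`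
  have hCS : (∑ p : V × V, G.c p.1 p.2 * |f p.1 ^ 2 - f p.2 ^ 2|) ^ 2 ≤
      (∑ p : V × V, G.c p.1 p.2 * (f p.1 - f p.2) ^ 2) *
        ∑ p : V × V, G.c p.1 p.2 * (f p.1 + f p.2) ^ 2 :=
    Finset.sum_sq_le_sum_mul_sum_of_sq_le_mul _
      (fun p _ => mul_nonneg (G.nonneg _ _) (sq_nonneg _))
      (fun p _ => mul_nonneg (G.nonneg _ _) (sq_nonneg _))
      fun p _ => le_of_eq (by rw [mul_pow, sq_abs]; ring)
  have hE : ∑ p : V × V, G.c p.1 p.2 * (f p.1 - f p.2) ^ 2 = 2 * G.energy f := by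
    rw [two_mul_energy, Fintype.sum_prod_type]
  have hN : ∑ p : V × V, G.c p.1 p.2 * (f p.1 + f p.2) ^ 2 ≤ 4 * G.sqNorm f := by
    calc ∑ p : V × V, G.c p.1 p.2 * (f p.1 + f p.2) ^ 2
        ≤ ∑ p : V × V, 2 * (G.c p.1 p.2 * (f p.1 ^ 2 + f p.2 ^ 2)) := by
          refine Finset.sum_le_sum fun p _ => ?_
          rw [mul_left_comm]
          exact mul_le_mul_of_nonneg_left add_sq_le (G.nonneg _ _)
      _ = 4 * G.sqNorm f := by
        rw [← Finset.mul_sum, sum_c_mul_sq_add_sq]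
        ring
  rw [← two_mul_integral_cut_superlevel_sqrt G hf, hE] at hCS
  nlinarith [mul_le_mul_of_nonneg_left hN (G.energy_nonneg f)]

theorem integral_cut_superlevel_sqrt_le {f : V → ℝ} (hf : 0 ≤ f) {l : ℝ} (hl : l ≤ 1 / 288)
    (h : G.energy f ≤ l * G.sqNorm f) :
    ∫ τ in Set.Ioi 0, G.cut (superlevel f √τ) (superlevel f √τ)ᶜ ≤ G.sqNorm f / 12 := by
  have hM := G.sqNorm_nonneg f
  refine le_of_sq_le_sq ?_ (by positivity)
  refine (G.sq_integral_cut_superlevel_sqrt_le hf).trans ?_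
  nlinarith [mul_le_mul_of_nonneg_right (h.trans (mul_le_mul_of_nonneg_right hl hM)) hM]

theorem energy_ramp_sqrt_le {f : V → ℝ} (hf : 0 ≤ f) {τ : ℝ} (hτ : 0 < τ) :
    G.energy (fun v => ramp √τ (f v)) ≤ G.rampMajorant f τ := by
  refine le_of_mul_le_mul_left ?_ (two_pos (α := ℝ))
  rw [two_mul_energy, ← Fintype.sum_prod_type', rampMajorant, stepSum, Finset.mul_sum]
  refine Finset.sum_le_sum fun p _ => ?_
  refine (mul_le_mul_of_nonneg_left
    (sq_ramp_sub_ramp_le (Real.sqrt_pos.mpr hτ) (hf p.1) (hf p.2)) (G.nonneg _ _)).trans_eq ?_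
  simp only [Set.indicator_apply, Pi.zero_apply, Real.sq_sqrt hτ.le]
  split_ifs <;> ring

theorem integral_rampMajorant_le (f : V → ℝ) :
    ∫ τ in Set.Ioi 0, G.rampMajorant f τ ≤ 16 * G.energy f := by
  have hE : 16 * G.energy f = ∑ p : V × V, 8 * (G.c p.1 p.2 * (f p.1 - f p.2) ^ 2) := by
    rw [← Finset.mul_sum, Fintype.sum_prod_type, ← two_mul_energy]
    ring
  rw [rampMajorant, setIntegral_Ioi_stepSum (a := 0) (c := 0) _ _ fun _ => le_rfl, hE]
  refine Finset.sum_le_sum fun p _ => ?_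
  rw [Pi.zero_apply, sub_zero, max_eq_left (by positivity)]
  rcases eq_or_ne (max (f p.1) (f p.2)) 0 with h | h
  · rw [h]
    have := mul_nonneg (G.nonneg p.1 p.2) (sq_nonneg (f p.1 - f p.2))
    simpa
  · exact le_of_eq (by field_simp; ring)

theorem integrableOn_energy_ramp_sqrt {f : V → ℝ} (hf : 0 ≤ f) :
    IntegrableOn (fun τ => G.energy fun v => ramp √τ (f v)) (Set.Ioi 0) := by
  have hmeas : Measurable fun τ => G.energy fun v => ramp √τ (f v) := by
    unfold energy dotProduct Matrix.mulVec dotProduct ramp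
    fun_prop
  refine (G.integrable_rampMajorant f).integrableOn.mono' hmeas.aestronglyMeasurable ?_
  filter_upwards [ae_restrict_mem measurableSet_Ioi] with τ hτ
  rw [Real.norm_of_nonneg (G.energy_nonneg _)]
  exact G.energy_ramp_sqrt_le hf hτ

theorem integral_energy_ramp_sqrt_le {f : V → ℝ} (hf : 0 ≤ f) :
    ∫ τ in Set.Ioi 0, G.energy (fun v => ramp √τ (f v)) ≤ 16 * G.energy f :=
  (setIntegral_mono_on (G.integrableOn_energy_ramp_sqrt hf)
    (G.integrable_rampMajorant f).integrableOn measurableSet_Ioi fun _ hτ =>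
      G.energy_ramp_sqrt_le hf hτ).trans (G.integral_rampMajorant_le f)

theorem exists_threshold {f : V → ℝ} (hf : 0 ≤ f) (hM : 0 < G.sqNorm f) {l : ℝ} (hl : 0 < l)
    (hl' : l ≤ 1 / 288) (hE : G.energy f ≤ l * G.sqNorm f) :
    ∃ t > 0, 2 * G.cut (superlevel f t) (superlevel f t)ᶜ +
      2 * G.cut (superlevel f (t / 2)) (superlevel f (t / 2))ᶜ +
      G.energy (fun v => ramp t (f v)) / (144 * l) < G.vol (superlevel f t) := by
  have hf2 : 0 ≤ (2 : ℝ) • f := smul_nonneg two_pos.le hf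
  have hM2 : G.sqNorm ((2 : ℝ) • f) = 4 * G.sqNorm f := by
    simp only [sqNorm, Finset.mul_sum, Pi.smul_apply, smul_eq_mul]
    exact Finset.sum_congr rfl fun v _ => by ring
  have hE2 : G.energy ((2 : ℝ) • f) ≤ l * G.sqNorm ((2 : ℝ) • f) := by
    rw [energy_smul, hM2]
    linarith
  have hcut := G.integral_cut_superlevel_sqrt_le hf hl' hE
  have hcut2 := G.integral_cut_superlevel_sqrt_le hf2 hl' hE2
  have hramp : (∫ τ in Set.Ioi 0, G.energy fun v => ramp √τ (f v)) / (144 * l) ≤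
      G.sqNorm f / 9 := by
    rw [div_le_iff₀ (by positivity)]
    linarith [G.integral_energy_ramp_sqrt_le hf]
  -- the three summands integrate to at most `1 / 6`, `2 / 3` and `1 / 9` of `G.sqNorm f`
  have hint := (G.integrableOn_cut_superlevel_sqrt hf).const_mul 2
  have hint2 := (G.integrableOn_cut_superlevel_sqrt hf2).const_mul 2
  have hintramp := (G.integrableOn_energy_ramp_sqrt hf).div_const (144 * l)
  obtain ⟨τ, hτ, hlt⟩ := exists_mem_lt_of_setIntegral_lt measurableSet_Ioi
    ((hint.add hint2).add hintramp) (G.integrableOn_vol_superlevel_sqrt hf) <| by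
      rw [integral_add' (hint.add hint2) hintramp,
        integral_add' hint hint2, integral_const_mul,
        integral_const_mul, integral_div,
        integral_vol_superlevel_sqrt G hf]
      linarith
  refine ⟨√τ, Real.sqrt_pos.mpr hτ, ?_⟩
  simpa only [Pi.add_apply, superlevel_smul two_pos] using hlt

end Sweep

section UpperBound

variable {V : Type*} [Fintype V] {G : WeightedGraph V}

theorem sqNorm_le_sqNorm_sub_const {y : V → ℝ} (hy : ∑ v, G.deg v * y v = 0) (t : ℝ) :
    G.sqNorm y ≤ G.sqNorm fun v => y v - t := by
  have hsum : G.sqNorm (fun v => y v - t) =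
      G.sqNorm y - 2 * t * ∑ v, G.deg v * y v + t ^ 2 * ∑ v, G.deg v := by
    simp only [sqNorm, Finset.mul_sum, ← Finset.sum_add_distrib, ← Finset.sum_sub_distrib]
    exact Finset.sum_congr rfl fun v _ => by ring
  rw [hsum, hy, mul_zero, sub_zero]
  exact le_add_of_nonneg_right
    (mul_nonneg (sq_nonneg t) (Finset.sum_nonneg fun v _ => G.deg_nonneg v))

variable [DecidableEq V]

theorem energy_posPart_le_or_energy_negPart_le {x : V → ℝ} {l : ℝ} (hx : 0 < G.sqNorm x)
    (hE : G.energy x ≤ l * G.sqNorm x) :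
    (0 < G.sqNorm x⁺ ∧ G.energy x⁺ ≤ l * G.sqNorm x⁺) ∨
      (0 < G.sqNorm x⁻ ∧ G.energy x⁻ ≤ l * G.sqNorm x⁻) := by
  have hN := G.sqNorm_posPart_add_sqNorm_negPart x
  have hEadd := G.energy_posPart_add_energy_negPart_le x
  have hpos := G.energy_nonneg x⁺
  have hneg := G.energy_nonneg x⁻
  rw [← hN, mul_add] at hE
  rcases (G.sqNorm_nonneg x⁺).eq_or_lt with hp | hp
  · rw [← hp] at hN hE
    exact Or.inr ⟨by linarith, by linarith⟩
  rcases le_or_gt (G.energy x⁺) (l * G.sqNorm x⁺) with hle | hgt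
  · exact Or.inl ⟨hp, hle⟩
  refine Or.inr ⟨(G.sqNorm_nonneg x⁻).lt_of_ne' fun h => ?_, by linarith⟩
  rw [h] at hE
  linarith

theorem Connected.exists_test_function [Nontrivial V] (hG : G.Connected) :
    ∃ f : V → ℝ, 0 ≤ f ∧ 0 < G.sqNorm f ∧ G.energy f ≤ G.spectralGap * G.sqNorm f ∧
      2 * G.vol {v | 0 < f v} ≤ ∑ v, G.deg v := by
  obtain ⟨y, hy0, hy, hE⟩ := hG.exists_eigenfunction hG.isLeast_spectralGap.1
  obtain ⟨m, hbelow, habove⟩ := exists_weighted_median G.deg_nonneg y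
  let x : V → ℝ := fun v => y v - y m
  have hnorm : G.sqNorm y ≤ G.sqNorm x := sqNorm_le_sqNorm_sub_const hy _
  have hEx : G.energy x ≤ G.spectralGap * G.sqNorm x := by
    calc G.energy x = G.spectralGap * G.sqNorm y := (G.energy_sub_const y _).trans hE
      _ ≤ G.spectralGap * G.sqNorm x := mul_le_mul_of_nonneg_left hnorm hG.spectralGap_pos.le
  rcases energy_posPart_le_or_energy_negPart_le ((hG.sqNorm_pos hy0).trans_le hnorm) hEx with
    ⟨hpos, hle⟩ | ⟨hpos, hle⟩
  · refine ⟨x⁺, posPart_nonneg x, hpos, hle, ?_⟩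
    simpa only [vol, Pi.posPart_apply, posPart_pos_iff, x, sub_pos] using habove
  · refine ⟨x⁻, negPart_nonneg x, hpos, hle, ?_⟩
    simpa only [vol, Pi.negPart_apply, negPart_pos_iff, x, sub_neg] using hbelow

theorem vol_le_two_mul_schurVol {A X : Finset V} (hA : A ⊆ X) (hcut : 2 * G.cut A Aᶜ ≤ G.vol A) :
    G.vol A ≤ 2 * G.schurVol X A := by
  linarith [G.cut_self_add_cut_compl A, G.cut_self_le_schurVol hA]

theorem Connected.schurConductance_le_of_energy_le (hG : G.Connected) {A B : Finset V}
    (hA : A.Nonempty) (hd : Disjoint A B) (hcutA : 2 * G.cut A Aᶜ ≤ G.vol A)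
    (hcutB : 2 * G.cut B Bᶜ ≤ G.vol B) (hAB : G.vol A ≤ G.vol B) {x : V → ℝ}
    (h1 : ∀ v ∈ A, x v = 1) (h0 : ∀ v ∈ B, x v = 0) {l : ℝ} (hl : 0 ≤ l)
    (hE : G.energy x ≤ l * G.vol A) : G.schurConductance A B ≤ 2 * l := by
  have hmin : G.vol A ≤ 2 * min (G.schurVol (A ∪ B) A) (G.schurVol (A ∪ B) B) := by
    rw [mul_min_of_nonneg _ _ two_pos.le]
    exact le_min (vol_le_two_mul_schurVol Finset.subset_union_left hcutA)
      (hAB.trans (vol_le_two_mul_schurVol Finset.subset_union_right hcutB))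
  rw [schurConductance_eq]
  refine div_le_of_le_mul₀ (by linarith [G.vol_nonneg A]) (by positivity) ?_
  calc G.schurCut A B ≤ l * G.vol A := (hG.schurCut_le_energy hA hd h1 h0).trans hE
    _ ≤ l * (2 * min (G.schurVol (A ∪ B) A) (G.schurVol (A ∪ B) B)) := by gcongr
    _ = 2 * l * min (G.schurVol (A ∪ B) A) (G.schurVol (A ∪ B) B) := by ring

theorem Connected.exists_schurConductance_le_of_threshold (hG : G.Connected) {f : V → ℝ}
    {t l : ℝ} (ht : 0 < t) (hl : 0 < l)
    (hvol : 2 * G.vol (superlevel f (t / 2)) ≤ ∑ v, G.deg v)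
    (hsweep : 2 * G.cut (superlevel f t) (superlevel f t)ᶜ +
      2 * G.cut (superlevel f (t / 2)) (superlevel f (t / 2))ᶜ +
      G.energy (fun v => ramp t (f v)) / l < G.vol (superlevel f t)) :
    ∃ A B : Finset V, A.Nonempty ∧ B.Nonempty ∧ Disjoint A B ∧ G.schurConductance A B ≤ 2 * l := by
  set A := superlevel f t
  set C := superlevel f (t / 2)
  have hAC : A ⊆ C := fun v hv =>
    mem_superlevel.mpr ((half_le_self ht.le).trans (mem_superlevel.mp hv))
  have hcutA := G.cut_nonneg A Aᶜ
  have hcutC := G.cut_nonneg C Cᶜ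
  have hE : 0 ≤ G.energy (fun v => ramp t (f v)) / l := div_nonneg (G.energy_nonneg _) hl.le
  have hA0 : 0 < G.vol A := by linarith
  have hvolAC : G.vol A ≤ G.vol Cᶜ := by linarith [G.vol_add_vol_compl C, G.vol_mono hAC]
  have hA : A.Nonempty := nonempty_of_vol_pos hA0
  have hd : Disjoint A Cᶜ := disjoint_compl_right_iff.mpr hAC
  refine ⟨A, Cᶜ, hA, nonempty_of_vol_pos (hA0.trans_le hvolAC), hd, ?_⟩
  refine hG.schurConductance_le_of_energy_le hA hd (by linarith) ?_ hvolAC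
    (fun v hv => ramp_eq_one ht (mem_superlevel.mp hv)) (fun v hv => ramp_eq_zero ht ?_) hl.le
    ((div_le_iff₀' hl).mp (by linarith))
  · rw [compl_compl, cut_comm]
    linarith
  · exact (not_le.mp (mt mem_superlevel.mpr (Finset.mem_compl.mp hv))).le

theorem Connected.exists_schurConductance_le [Nontrivial V] (hG : G.Connected)
    (hl : G.spectralGap ≤ 1 / 288) :
    ∃ A B : Finset V, A.Nonempty ∧ B.Nonempty ∧ Disjoint A B ∧
      G.schurConductance A B ≤ 288 * G.spectralGap := by
  obtain ⟨f, hf, hM, hE, hhalf⟩ := hG.exists_test_function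
  obtain ⟨t, ht, hsweep⟩ := G.exists_threshold hf hM hG.spectralGap_pos hl hE
  have hsupp : superlevel f (t / 2) ⊆ ({v | 0 < f v} : Finset V) := fun v hv =>
    (Finset.mem_filter_univ v).mpr ((half_pos ht).trans_le (mem_superlevel.mp hv))
  obtain ⟨A, B, hA, hB, hd, hle⟩ := hG.exists_schurConductance_le_of_threshold ht
    (mul_pos (by norm_num) hG.spectralGap_pos)
    ((mul_le_mul_of_nonneg_left (G.vol_mono hsupp) two_pos.le).trans hhalf) hsweep
  exact ⟨A, B, hA, hB, hd, hle.trans_eq (by ring)⟩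

theorem Connected.minSchurConductance_le [Nontrivial V] (hG : G.Connected) :
    G.minSchurConductance ≤ 288 * G.spectralGap := by
  rcases le_total G.spectralGap (1 / 288) with hl | hl
  · obtain ⟨A, B, hA, hB, hd, hle⟩ := hG.exists_schurConductance_le hl
    exact (G.isLeast_minSchurConductance.2 ⟨A, B, hA, hB, hd, rfl⟩).trans hle
  · obtain ⟨A, B, -, -, -, h⟩ := G.isLeast_minSchurConductance.1
    linarith [G.schurConductance_le_one A B]

end UpperBound

end WeightedGraph

theorem theorem2_general {V : Type*} [Fintype V] [DecidableEq V] [Nontrivial V]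
    (G : WeightedGraph V) (hG : G.Connected) :
    IsLeast G.nonzeroEigenvalues G.spectralGap ∧
      IsLeast G.schurConductances G.minSchurConductance ∧
      G.spectralGap / 2 ≤ G.minSchurConductance ∧
      G.minSchurConductance ≤ 288 * G.spectralGap := by
  refine ⟨hG.isLeast_spectralGap, G.isLeast_minSchurConductance, ?_, hG.minSchurConductance_le⟩
  obtain ⟨A, B, hA, hB, hd, hρ⟩ := G.isLeast_minSchurConductance.1
  exact hρ ▸ hG.spectralGap_div_two_le_schurConductance hA hB hd

theorem theorem2 {V : Type*} [Fintype V] [DecidableEq V] [Nontrivial V]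
    (G : WeightedGraph V) (hG : G.Connected) :
    IsLeast G.nonzeroEigenvalues G.spectralGap ∧
      IsLeast G.schurConductances G.minSchurConductance ∧
      G.spectralGap / 2 ≤ G.minSchurConductance ∧
      G.minSchurConductance ≤ 25600 * G.spectralGap := by
  obtain ⟨hgap, hmin, hlower, hupper⟩ := theorem2_general G hG
  exact ⟨hgap, hmin, hlower, by linarith [hG.spectralGap_pos]⟩
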